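/- All links are unoriented tame links in $S^3$ up to ambient isotopy, i.e. plane link diagrams up to plane isotopy and Reidemeister moves. For a diagram $D$ of a link $L$, the associated core group $\Pi_L^{(2)}=\Pi_D^{(2)}$ is the group with one generator for each arc of $D$ and one relator $yx^{-1}yz^{-1}$ for each crossing, where $y$ is the overpass and $x,z$ are the underpasses at the crossing. A $4$-move on a link replaces two parallel strands of a diagram by the same two strands with four half twists (of either handedness) inserted; two links are $4$-move equivalent if they are related by a finite sequence of $4$-moves and their inverses. The Magnus $\mathbb{Z}_2$-expansion $E^2$ is the homomorphism from the free group $F_m=\langle x_1,\ldots,x_m\rangle$ to the group of units of the ring of formal power series in non-commuting variables $X_1,\ldots,X_m$ over $\mathbb{Z}_2=\mathbb{Z}/2\mathbb{Z}$ with $E^2(x_i)=1+X_i$ and $E^2(x_i^{-1})=1-X_i+X_i^2-X_i^3+\cdots$. Theorem. Let $L$ be an $m$-component link and let $R\subset F_m$ be a set of words such that $\Pi_L^{(2)}\cong\langle x_1,\ldots,x_m\mid R\rangle$. If $L$ is $4$-move equivalent to a trivial link (with any number of components), then for every $r\in R$ \[ E^{2}(r)=1+\sum_{(i_1,i_2,i_3,i_4)}c(i_1,i_2,i_3,i_4)\,X_{i_1}X_{i_2}X_{i_3}X_{i_4}+d(5)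 \] for some $c(i_1,i_2,i_3,i_4)\in\mathbb{Z}_2$ such that $c(i_1,i_2,i_3,i_4)=c(i_{\sigma(1)},i_{\sigma(2)},i_{\sigma(3)},i_{\sigma(4)})$ for every permutation $\sigma$ of $\{1,2,3,4\}$, where $(i_1,i_2,i_3,i_4)$ runs over $\{1,\ldots,m\}^4$ and $d(5)$ denotes a power series all of whose terms have degree $\ge 5$. -/

import Mathlib

/-! ## Non-commutative formal power series and the Magnus expansion -/

/-- The formal power series in non-commuting variables indexed by `σ`, with coefficients
in `A`: a series is the family of its coefficients, one for each word (monomial) in `σ`. -/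
def NCPowerSeries (σ A : Type*) : Type _ := List σ → A

namespace NCPowerSeries

instance instAddCommGroup (σ A : Type*) [CommRing A] : AddCommGroup (NCPowerSeries σ A) :=
  inferInstanceAs (AddCommGroup (List σ → A))

instance instModule (σ A : Type*) [CommRing A] : Module A (NCPowerSeries σ A) :=
  inferInstanceAs (Module A (List σ → A))

/-- The series `1`: coefficient `1` at the empty word, `0` elsewhere. -/
instance instOne (σ A : Type*) [CommRing A] : One (NCPowerSeries σ A) :=
  ⟨fun w => match w with
    | [] => 1
    | _ :: _ => 0⟩

/-- The Cauchy product: sum over all ways of cutting a word in two. -/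
instance instMul (σ A : Type*) [CommRing A] : Mul (NCPowerSeries σ A) :=
  ⟨fun f g w => ∑ k ∈ Finset.range (w.length + 1), f (w.take k) * g (w.drop k)⟩

/-- Auxiliary: the series of the coefficients of the words that start with `a`. -/
def tail {σ A : Type*} (a : σ) (f : NCPowerSeries σ A) : NCPowerSeries σ A := fun w => f (a :: w)

theorem mul_nil {σ A : Type*} [CommRing A] (f g : NCPowerSeries σ A) :
    (f * g) [] = f [] * g [] := by
  change ∑ k ∈ Finset.range 1, f (List.take k []) * g (List.drop k []) = _
  simp

theorem mul_cons {σ A : Type*} [CommRing A] (f g : NCPowerSeries σ A) (a : σ) (w : List σ) :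
    (f * g) (a :: w) = f [] * g (a :: w) + (tail a f * g) w := by
  change ∑ k ∈ Finset.range (w.length + 1 + 1), f (List.take k (a :: w)) *
    g (List.drop k (a :: w)) = _
  rw [Finset.sum_range_succ', add_comm]
  rfl

theorem add_app {σ A : Type*} [CommRing A] (f g : NCPowerSeries σ A) (w : List σ) :
    (f + g) w = f w + g w := rfl

theorem add_mul_app {σ A : Type*} [CommRing A] (f g h : NCPowerSeries σ A) (w : List σ) :
    ((f + g) * h) w = (f * h) w + (g * h) w := by
  change ∑ k ∈ _, (f _ + g _) * h _ = ∑ k ∈ _, _ + ∑ k ∈ _, _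
  rw [← Finset.sum_add_distrib]
  exact Finset.sum_congr rfl fun k _ => add_mul _ _ _

theorem mul_add_app {σ A : Type*} [CommRing A] (f g h : NCPowerSeries σ A) (w : List σ) :
    (f * (g + h)) w = (f * g) w + (f * h) w := by
  change ∑ k ∈ _, f _ * (g _ + h _) = ∑ k ∈ _, _ + ∑ k ∈ _, _
  rw [← Finset.sum_add_distrib]
  exact Finset.sum_congr rfl fun k _ => mul_add _ _ _

theorem smul_mul_app {σ A : Type*} [CommRing A] (c : A) (f g : NCPowerSeries σ A) (w : List σ) :
    ((c • f) * g) w = c * (f * g) w := by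
  change ∑ k ∈ _, (c * f _) * g _ = c * ∑ k ∈ _, _
  rw [Finset.mul_sum]
  exact Finset.sum_congr rfl fun k _ => mul_assoc _ _ _

theorem zero_mul_app {σ A : Type*} [CommRing A] (f : NCPowerSeries σ A) (w : List σ) :
    ((0 : NCPowerSeries σ A) * f) w = 0 :=
  Finset.sum_eq_zero fun _ _ => zero_mul _

theorem mul_zero_app {σ A : Type*} [CommRing A] (f : NCPowerSeries σ A) (w : List σ) :
    (f * (0 : NCPowerSeries σ A)) w = 0 :=
  Finset.sum_eq_zero fun _ _ => mul_zero _

theorem one_mul_app {σ A : Type*} [CommRing A] (f : NCPowerSeries σ A) (w : List σ) :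
    ((1 : NCPowerSeries σ A) * f) w = f w := by
  cases w with
  | nil => rw [mul_nil]; exact one_mul _
  | cons a w =>
    rw [mul_cons]
    have h : tail a (1 : NCPowerSeries σ A) = 0 := rfl
    rw [h, zero_mul_app, add_zero]
    exact one_mul _

theorem mul_one_app {σ A : Type*} [CommRing A] (f : NCPowerSeries σ A) (w : List σ) :
    (f * (1 : NCPowerSeries σ A)) w = f w := by
  induction w generalizing f with
  | nil => rw [mul_nil]; exact mul_one _
  | cons a w ih =>
    rw [mul_cons, ih]
    have h : (1 : NCPowerSeries σ A) (a :: w) = 0 := rfl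
    rw [h, mul_zero, zero_add]
    rfl

theorem mul_assoc_app {σ A : Type*} [CommRing A] (f g h : NCPowerSeries σ A) (w : List σ) :
    (f * g * h) w = (f * (g * h)) w := by
  induction w generalizing f g h with
  | nil => simp only [mul_nil, mul_assoc]
  | cons a w ih =>
    have e : tail a (f * g) = f [] • tail a g + tail a f * g := by
      funext v
      exact mul_cons f g a v
    rw [mul_cons, mul_cons f, mul_nil, mul_cons g, e, add_mul_app, smul_mul_app, ih]
    ring

instance instRing (σ A : Type*) [CommRing A] : Ring (NCPowerSeries σ A) where
  __ := instAddCommGroup σ A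
  __ := instOne σ A
  __ := instMul σ A
  left_distrib f g h := funext (mul_add_app f g h)
  right_distrib f g h := funext (add_mul_app f g h)
  zero_mul f := funext (zero_mul_app f)
  mul_zero f := funext (mul_zero_app f)
  mul_assoc f g h := funext (mul_assoc_app f g h)
  one_mul f := funext (one_mul_app f)
  mul_one f := funext (mul_one_app f)

/-- The variable `X_i`. -/
def X {σ : Type*} (A : Type*) [CommRing A] [DecidableEq σ] (i : σ) : NCPowerSeries σ A :=
  fun w => if w = [i] then 1 else 0

/-- The series `1 - X_i + X_i ^ 2 - X_i ^ 3 + ⋯`. -/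
def altGeom {σ : Type*} (A : Type*) [CommRing A] [DecidableEq σ] (i : σ) : NCPowerSeries σ A :=
  fun w => if w = List.replicate w.length i then (-1) ^ w.length else 0

theorem one_add_X_app {σ : Type*} (A : Type*) [CommRing A] [DecidableEq σ] (i : σ) :
    (1 + X A i : NCPowerSeries σ A) [] = 1 := by
  change (1 : A) + (if ([] : List σ) = [i] then 1 else 0) = 1
  simp

theorem tail_one_add_X {σ : Type*} (A : Type*) [CommRing A] [DecidableEq σ] (i a : σ) :
    tail a (1 + X A i : NCPowerSeries σ A) = (if a = i then (1 : A) else 0) • 1 := by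
  funext w
  change (0 : A) + (if a :: w = [i] then 1 else 0) =
    (if a = i then (1 : A) else 0) * (1 : NCPowerSeries σ A) w
  cases w with
  | nil =>
    have h : (1 : NCPowerSeries σ A) [] = 1 := rfl
    simp [h]
  | cons b w =>
    have h : (1 : NCPowerSeries σ A) (b :: w) = 0 := rfl
    simp [h]

theorem altGeom_cons {σ : Type*} (A : Type*) [CommRing A] [DecidableEq σ] (i a : σ)
    (w : List σ) : altGeom A i (a :: w) = -(if a = i then (1 : A) else 0) * altGeom A i w := by
  simp only [altGeom, List.length_cons, List.replicate_succ, List.cons.injEq]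
  by_cases h1 : a = i <;> by_cases h2 : w = List.replicate w.length i
  · rw [if_pos ⟨h1, h2⟩, if_pos h1, if_pos h2]; ring
  · rw [if_neg fun h => h2 h.2, if_neg h2]; ring
  · rw [if_neg fun h => h1 h.1, if_neg h1]; ring
  · rw [if_neg fun h => h1 h.1, if_neg h1]; ring

theorem one_add_X_mul_altGeom {σ : Type*} (A : Type*) [CommRing A] [DecidableEq σ] (i : σ) :
    (1 + X A i : NCPowerSeries σ A) * altGeom A i = 1 := by
  funext w
  cases w with
  | nil =>
    rw [mul_nil, one_add_X_app]
    change 1 * (if [] = List.replicate 0 i then (-1 : A) ^ 0 else 0) = 1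
    simp
  | cons a w =>
    rw [mul_cons, one_add_X_app, tail_one_add_X, smul_mul_app, one_mul_app, altGeom_cons]
    change _ = (0 : A)
    ring

theorem altGeom_mul_one_add_X {σ : Type*} (A : Type*) [CommRing A] [DecidableEq σ] (i : σ) :
    altGeom A i * (1 + X A i : NCPowerSeries σ A) = 1 := by
  have h0 : altGeom A i [] = 1 := by
    change (if [] = List.replicate 0 i then (-1 : A) ^ 0 else 0) = 1
    simp
  have ht : ∀ a : σ, tail a (altGeom A i) = (-(if a = i then (1 : A) else 0)) • altGeom A i :=
    fun a => funext fun w => altGeom_cons A i a w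
  funext w
  induction w with
  | nil => rw [mul_nil, one_add_X_app, h0]; exact mul_one _
  | cons a w ih =>
    rw [mul_cons, h0, ht, smul_mul_app, ih]
    have h := congrFun (tail_one_add_X A i a) w
    change (1 + X A i : NCPowerSeries σ A) (a :: w) =
      (if a = i then (1 : A) else 0) * (1 : NCPowerSeries σ A) w at h
    rw [h]
    change _ = (0 : A)
    ring

/-- `1 + X_i` as a unit, with inverse `1 - X_i + X_i ^ 2 - ⋯`. -/
def unitOneAddX {σ : Type*} (A : Type*) [CommRing A] [DecidableEq σ] (i : σ) :
    (NCPowerSeries σ A)ˣ where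
  val := 1 + X A i
  inv := altGeom A i
  val_inv := one_add_X_mul_altGeom A i
  inv_val := altGeom_mul_one_add_X A i

/-- `f` consists of terms of degree at least `k` only. -/
def DegreeGE {σ A : Type*} [CommRing A] (k : ℕ) (f : NCPowerSeries σ A) : Prop :=
  ∀ w : List σ, w.length < k → f w = 0

end NCPowerSeries

/-- The Magnus `ℤ/p`-expansion: the homomorphism from the free group on `x_1, …, x_m` to
(the units of) the power series ring in non-commuting variables `X_1, …, X_m` over `ℤ/p` with
`x_i ↦ 1 + X_i` and `x_i⁻¹ ↦ 1 - X_i + X_i ^ 2 - ⋯`. -/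
def magnusExpansion (p m : ℕ) :
    FreeGroup (Fin m) →* (NCPowerSeries (Fin m) (ZMod p))ˣ :=
  FreeGroup.lift fun i => NCPowerSeries.unitOneAddX (ZMod p) i

/-! ## Unoriented link diagrams

A plane link diagram in general position with respect to the height function is cut by horizontal
lines into slices, each with exactly one local minimum, one local maximum or one crossing, all
other strands being vertical.  Diagrams are read from bottom to top, and the strands met by a
horizontal line are numbered `0, 1, 2, …` from left to right. -/

/-- An elementary slice; `i` strands run to the left of its event. -/
inductive Slice : Type
  /-- a local minimum: it gives birth to the adjacent strands `i` and `i + 1` -/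
  | cup (i : ℕ)
  /-- a local maximum: it joins the adjacent strands `i` and `i + 1` -/
  | cap (i : ℕ)
  /-- a crossing of the strands `i` and `i + 1`.  If `b = true`, the strand that runs from
  bottom left to top right is the overpass; if `b = false`, the one from bottom right to top
  left is. -/
  | cross (i : ℕ) (b : Bool)

namespace Slice

/-- The number of strands to the left of the event. -/
def pos : Slice → ℕ
  | cup i => i
  | cap i => i
  | cross i _ => i

/-- The number of strands that enter the event from below. -/
def src : Slice → ℕ
  | cup _ => 0
  | cap _ => 2
  | cross _ _ => 2

/-- The number of strands that leave the event at the top. -/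
def tgt : Slice → ℕ
  | cup _ => 2
  | cap _ => 0
  | cross _ _ => 2

/-- The same event, `k` places further to the right. -/
def shift (k : ℕ) : Slice → Slice
  | cup i => cup (i + k)
  | cap i => cap (i + k)
  | cross i b => cross (i + k) b

/-- The number of strands above the slice, if there are `n` strands below it. -/
def out (s : Slice) (n : ℕ) : ℕ := n - s.src + s.tgt

/-- For a slice between the horizontal lines `k` and `k + 1`: `Joins s k p q` says that `p` and
`q`, points (line, number of the strand) on these two lines, are the two ends of a piece of strand
in the slice that is not the underpass of a crossing. -/
inductive Joins : Slice → ℕ → ℕ × ℕ → ℕ × ℕ → Prop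
  | left (s : Slice) (k j : ℕ) (h : j < s.pos) : Joins s k (k, j) (k + 1, j)
  | right (s : Slice) (k j : ℕ) :
      Joins s k (k, s.pos + s.src + j) (k + 1, s.pos + s.tgt + j)
  | cup (i k : ℕ) : Joins (cup i) k (k + 1, i) (k + 1, i + 1)
  | cap (i k : ℕ) : Joins (cap i) k (k, i) (k, i + 1)
  | over_true (i k : ℕ) : Joins (cross i true) k (k, i) (k + 1, i + 1)
  | over_false (i k : ℕ) : Joins (cross i false) k (k, i + 1) (k + 1, i)

/-- `Crossing s k x y z` says that the slice `s` between the horizontal lines `k` and `k + 1` is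
a crossing, that `x` and `z` are the two ends of its underpass (`x` below, `z` above), and that `y`
is the lower end of its overpass. -/
inductive Crossing : Slice → ℕ → ℕ × ℕ → ℕ × ℕ → ℕ × ℕ → Prop
  | pos (i k : ℕ) : Crossing (cross i true) k (k, i + 1) (k, i) (k + 1, i)
  | neg (i k : ℕ) : Crossing (cross i false) k (k, i) (k, i + 1) (k + 1, i + 1)

end Slice

/-- `IsTangle w n n'`: the slices of `w` can be stacked on `n` strands, and there are `n'` strands
at the top. -/
def IsTangle : List Slice → ℕ → ℕ → Prop
  | [], n, n' => n = n'
  | s :: w, n, n' => s.pos + s.src ≤ n ∧ IsTangle w (s.out n) n'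

/-- An unoriented link diagram: a stack of slices with no strand at the bottom or at the top. -/
structure LinkDiagram : Type where
  slices : List Slice
  closed : IsTangle slices 0 0

namespace LinkDiagram

/-- The number of strands met by the `k`-th horizontal line, the one above the first `k` slices. -/
def width (D : LinkDiagram) (k : ℕ) : ℕ := (D.slices.take k).foldl (fun n s => s.out n) 0

/-- The points `(k, j)` in which the horizontal lines meet the diagram. -/
def Point (D : LinkDiagram) : Type :=
  {p : ℕ × ℕ // p.1 ≤ D.slices.length ∧ p.2 < D.width p.1}

/-- Two points are joined by a piece of strand within a slice that is not an underpass. -/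
def Adj (D : LinkDiagram) (p q : D.Point) : Prop :=
  ∃ (k : ℕ) (s : Slice), D.slices[k]? = some s ∧ s.Joins k p.1 q.1

/-- `x`, `z` are the ends of the underpass and `y` is a point of the overpass at a crossing. -/
def CrossingAt (D : LinkDiagram) (x y z : D.Point) : Prop :=
  ∃ (k : ℕ) (s : Slice), D.slices[k]? = some s ∧ s.Crossing k x.1 y.1 z.1

/-- The arcs of the diagram: it is cut at the underpasses only. -/
def Arc (D : LinkDiagram) : Type := Quot D.Adj

/-- The components of the link: strands are followed through overpasses and underpasses. -/
def Component (D : LinkDiagram) : Type :=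
  Quot fun p q : D.Point => D.Adj p q ∨ ∃ y, D.CrossingAt p y q

/-- The number of components. -/
noncomputable def numComponents (D : LinkDiagram) : ℕ := Nat.card D.Component

/-- The arc through a point, as a generator. -/
def arcGen (D : LinkDiagram) (p : D.Point) : FreeGroup D.Arc := FreeGroup.of (Quot.mk _ p)

/-- The relators `y x⁻¹ y z⁻¹`, one for each crossing. -/
def coreRelators (D : LinkDiagram) : Set (FreeGroup D.Arc) :=
  {ρ | ∃ x y z : D.Point, D.CrossingAt x y z ∧
    ρ = D.arcGen y * (D.arcGen x)⁻¹ * D.arcGen y * (D.arcGen z)⁻¹}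

/-- The associated core group: a generator for each arc, and a relator `y x⁻¹ y z⁻¹` for each
crossing with overpass `y` and underpasses `x`, `z`. -/
abbrev CoreGroup (D : LinkDiagram) : Type := PresentedGroup D.coreRelators

/-- `D'` arises from `D` when one block of consecutive slices is replaced according to `ρ`. -/
def Rewrites (ρ : List Slice → List Slice → Prop) (D D' : LinkDiagram) : Prop :=
  ∃ u a b v : List Slice, ρ a b ∧ D.slices = u ++ a ++ v ∧ D'.slices = u ++ b ++ v

end LinkDiagram

/-! ## Links -/

/-- The local moves that generate isotopy of links: plane isotopy (the moves `exchange`, `zigzag`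
and `slide`) and the three Reidemeister moves. -/
inductive IsotopyMove : List Slice → List Slice → Prop
  /-- two events, the first to the left of the second, change their heights -/
  | exchange (s t : Slice) (h : s.pos ≤ t.pos) :
      IsotopyMove [s, t.shift s.tgt] [t.shift s.src, s]
  /-- a minimum and a neighbouring maximum cancel -/
  | zigzag_right (i : ℕ) : IsotopyMove [.cup i, .cap (i + 1)] []
  | zigzag_left (i : ℕ) : IsotopyMove [.cup (i + 1), .cap i] []
  /-- a strand is pulled across a maximum or a minimum -/
  | slide_cap (i : ℕ) (b : Bool) :
      IsotopyMove [.cross i b, .cap (i + 1)] [.cross (i + 1) (!b), .cap i]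
  | slide_cup (i : ℕ) (b : Bool) :
      IsotopyMove [.cup (i + 1), .cross i b] [.cup i, .cross (i + 1) (!b)]
  /-- first Reidemeister move -/
  | reidemeister_one_cap (i : ℕ) (b : Bool) : IsotopyMove [.cross i b, .cap i] [.cap i]
  | reidemeister_one_cup (i : ℕ) (b : Bool) : IsotopyMove [.cup i, .cross i b] [.cup i]
  /-- second Reidemeister move -/
  | reidemeister_two (i : ℕ) (b : Bool) : IsotopyMove [.cross i b, .cross i (!b)] []
  /-- third Reidemeister move -/
  | reidemeister_three (i : ℕ) (b : Bool) :
      IsotopyMove [.cross i b, .cross (i + 1) b, .cross i b]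
        [.cross (i + 1) b, .cross i b, .cross (i + 1) b]

/-- Links in the 3-sphere up to ambient isotopy: link diagrams up to the equivalence relation
generated by plane isotopy and the Reidemeister moves. -/
def Link : Type := Quot (LinkDiagram.Rewrites IsotopyMove)

/-- The link represented by a diagram. -/
def LinkDiagram.toLink (D : LinkDiagram) : Link := Quot.mk _ D

/-- `n` half twists, of either handedness, are inserted into two parallel strands. -/
inductive TwistMove (n : ℕ) : List Slice → List Slice → Prop
  | twist (i : ℕ) (b : Bool) : TwistMove n [] (List.replicate n (.cross i b))

theorem isTangle_circles (k : ℕ) :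
    IsTangle (List.replicate k [Slice.cup 0, Slice.cap 0]).flatten 0 0 := by
  induction k with
  | zero => rfl
  | succ k ih => exact ⟨le_refl 0, le_refl 2, ih⟩

/-- The crossingless diagram of `k` unnested circles. -/
def circlesDiagram (k : ℕ) : LinkDiagram :=
  ⟨(List.replicate k [Slice.cup 0, Slice.cap 0]).flatten, isTangle_circles k⟩

namespace Link

/-- An `n`-move, which inserts `n` half twists in some diagram of the link. -/
def NMove (n : ℕ) (L L' : Link) : Prop :=
  ∃ D D' : LinkDiagram, D.toLink = L ∧ D'.toLink = L' ∧ D.Rewrites (TwistMove n) D'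

/-- `n`-move equivalence: a finite sequence of `n`-moves, in either direction. -/
def NMoveEquivalent (n : ℕ) : Link → Link → Prop := Relation.EqvGen (NMove n)

/-- A trivial link: a link with a diagram that consists of disjoint unnested circles. -/
def IsTrivial (L : Link) : Prop := ∃ k : ℕ, L = (circlesDiagram k).toLink

end Link

/-! ## Sequences of colours -/

/-! Let `G` be a finite group with `g ^ 4 = 1` for all `g`. Homomorphisms from the core group to `G`
are core colourings of the diagram: arcs carry elements of `G`, with `z = y * x⁻¹ * y` at each
crossing. If two parallel strands have colours `x, y`, a half twist multiplies both on the left by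
`g = x * y⁻¹` or by `g⁻¹`, according to its handedness, and preserves `g`. Four half twists
therefore restore the colours, and the number of colourings is invariant under 4-moves.

A trivial link of `k` components has `|G| ^ k` colourings. For `G` of order two, colourings are
arbitrary functions on the components, so `k = m`. Hence `⟨x_1, …, x_m | R⟩` has `|G| ^ m`
homomorphisms to `G`, as many as the free group, and so every homomorphism `F_m → G` kills `R`
(`FreeGroup.map_eq_one_of_card_presentedGroup_hom`).

This is applied to the units of the power series ring modulo `symmetricUnits` of degree 4, a normal
subgroup of finite index. The quotient satisfies `g ^ 4 = 1`: over `ℤ/2`, `(1 + f) ^ 4 = 1 + f ^ 4`,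
and the degree 4 part of `f ^ 4` is the fourth power of a linear form, which has symmetric
coefficients (`pow_four_mem_symmetricUnits`). So `E²(r)` lies in the subgroup, which is the claim.

Colourings are counted by composing one transfer operator per slice, so that each local move becomes
an identity of operators. Rows of colours are infinite sequences, equal to `1` beyond the last
strand; thus the operators need not know the number of strands. `card_coreColourings` and
`coreGroupHomEquiv` relate this count to the core group. -/

/-- The sequence with first term `x`, followed by `a`. -/
def seqCons {α : Type*} (x : α) (a : ℕ → α) : ℕ → α
  | 0 => x
  | n + 1 => a n

/-- The sequence `a` without its first term. -/
def seqTail {α : Type*} (a : ℕ → α) : ℕ → α := fun n => a (n + 1)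

theorem seqCons_seqTail {α : Type*} (a : ℕ → α) : seqCons (a 0) (seqTail a) = a := by
  funext n
  cases n <;> rfl

theorem eq_seqCons_iff {α : Type*} {x : α} {a b : ℕ → α} :
    b = seqCons x a ↔ x = b 0 ∧ seqTail b = a := by
  constructor
  · rintro rfl
    exact ⟨rfl, rfl⟩
  · rintro ⟨rfl, rfl⟩
    exact (seqCons_seqTail b).symm

/-- Insertion of two terms `x` before the term `i`. -/
def insertPair {α : Type*} : ℕ → α → (ℕ → α) → ℕ → α
  | 0, x, a => seqCons x (seqCons x a)
  | i + 1, x, a => seqCons (a 0) (insertPair i x (seqTail a))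

/-- Deletion of the terms `i` and `i + 1`. -/
def deletePair {α : Type*} : ℕ → (ℕ → α) → ℕ → α
  | 0, a => seqTail (seqTail a)
  | i + 1, a => seqCons (a 0) (deletePair i (seqTail a))

/-- The action of a crossing of the strands `i` and `i + 1` on sequences of colours. -/
def crossPair {G : Type*} [Group G] : ℕ → Bool → (ℕ → G) → ℕ → G
  | 0, true, a => seqCons (a 0 * (a 1)⁻¹ * a 0) (seqCons (a 0) (seqTail (seqTail a)))
  | 0, false, a => seqCons (a 1) (seqCons (a 1 * (a 0)⁻¹ * a 1) (seqTail (seqTail a)))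
  | i + 1, b, a => seqCons (a 0) (crossPair i b (seqTail a))

/-! ## The transfer operators of slices -/

namespace Slice

variable {G : Type*} [Group G] [Fintype G] [DecidableEq G]

/-- If `f` counts the colourings above a slice as a function of the colours on its upper line,
then `s.transfer f` counts them, with the slice included, as a function of the colours on the
lower line. -/
def transfer : Slice → ((ℕ → G) → ℕ) → (ℕ → G) → ℕ
  | cup i, f, a => ∑ x, f (insertPair i x a)
  | cap i, f, a => if a i = a (i + 1) then f (deletePair i a) else 0
  | cross i b, f, a => f (crossPair i b a)

/-- The leftmost strand is a mere spectator of a shifted slice; this is what reduces every move to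
the far left. -/
theorem transfer_shift_one (s : Slice) (f : (ℕ → G) → ℕ) (a : ℕ → G) :
    (s.shift 1).transfer f a = s.transfer (fun b => f (seqCons (a 0) b)) (seqTail a) := by
  cases s <;> rfl

theorem transfer_zero (s : Slice) (a : ℕ → G) : s.transfer (fun _ => 0) a = 0 := by
  cases s <;> simp [transfer]

theorem transfer_sum {ι : Type*} (t : Finset ι) (s : Slice) (f : ι → (ℕ → G) → ℕ) (a : ℕ → G) :
    s.transfer (fun b => ∑ x ∈ t, f x b) a = ∑ x ∈ t, s.transfer (f x) a := by
  cases s with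
  | cup i => exact Finset.sum_comm
  | cap i =>
    simp only [transfer]
    split_ifs <;> simp
  | cross i b => rfl

theorem transfer_ite (p : Prop) [Decidable p] (s : Slice) (f : (ℕ → G) → ℕ) (a : ℕ → G) :
    s.transfer (fun b => if p then f b else 0) a = if p then s.transfer f a else 0 := by
  split_ifs
  · rfl
  · exact transfer_zero s a

/-- The composition of the transfer operators of a stack of slices. -/
def transferList (w : List Slice) (f : (ℕ → G) → ℕ) : (ℕ → G) → ℕ := w.foldr transfer f

theorem transferList_append (v w : List Slice) (f : (ℕ → G) → ℕ) :
    transferList (v ++ w) f = transferList v (transferList w f) :=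
  List.foldr_append

theorem transferList_shift_one (w : List Slice) (f : (ℕ → G) → ℕ) (a : ℕ → G) :
    transferList (w.map (shift 1)) f a =
      transferList w (fun b => f (seqCons (a 0) b)) (seqTail a) := by
  induction w generalizing a with
  | nil =>
    change f a = f _
    rw [seqCons_seqTail]
  | cons s w ih =>
    change (s.shift 1).transfer (transferList (w.map (shift 1)) f) a = s.transfer _ _
    rw [transfer_shift_one]
    congr 1
    funext b
    exact ih _

variable (G) in
/-- Two stacks of slices with the same transfer operator. -/
def TransferEquiv (v w : List Slice) : Prop :=
  ∀ (f : (ℕ → G) → ℕ) (a : ℕ → G), transferList v f a = transferList w f a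

theorem TransferEquiv.shift_one {v w : List Slice} (h : TransferEquiv G v w) :
    TransferEquiv G (v.map (shift 1)) (w.map (shift 1)) := by
  intro f a
  rw [transferList_shift_one, transferList_shift_one, h]

/-- The events act on disjoint strands. After moving `s` to the far left, this is linearity of the
operator of `t`: it commutes with the sum of a minimum and with the condition of a maximum. -/
theorem transferEquiv_exchange (s t : Slice) (h : s.pos ≤ t.pos) :
    TransferEquiv G [s, t.shift s.tgt] [t.shift s.src, s] := by
  have hs : ∀ (u : Slice) (f : (ℕ → G) → ℕ) (a : ℕ → G), (u.shift 2).transfer f a =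
      u.transfer (fun b => f (seqCons (a 0) (seqCons (a 1) b))) (seqTail (seqTail a)) := by
    intro u f a
    cases u <;> rfl
  obtain ⟨i, hi⟩ : ∃ i, s.pos = i := ⟨_, rfl⟩
  induction i generalizing s t with
  | zero =>
    intro f a
    have h0 : ∀ u : Slice, u.shift 0 = u := fun u => by cases u <;> rfl
    cases s with
    | cup i =>
      obtain rfl : i = 0 := hi
      change ∑ x, (t.shift 2).transfer f _ = (t.shift 0).transfer (fun b => ∑ x, _) a
      rw [h0, transfer_sum]
      refine Finset.sum_congr rfl fun x _ => ?_
      rw [hs]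
      rfl
    | cap i =>
      obtain rfl : i = 0 := hi
      change (if a 0 = a 1 then (t.shift 0).transfer f _ else 0) = (t.shift 2).transfer _ a
      rw [h0, hs, ← transfer_ite]
      rfl
    | cross i b =>
      obtain rfl : i = 0 := hi
      change (t.shift 2).transfer f _ = (t.shift 2).transfer _ a
      rw [hs, hs]
      cases b <;> rfl
  | succ i ih =>
    obtain ⟨s, rfl⟩ : ∃ s', s = shift 1 s' := by
      cases s <;> obtain rfl := hi
      exacts [⟨cup i, rfl⟩, ⟨cap i, rfl⟩, ⟨cross i _, rfl⟩]
    obtain ⟨t, rfl⟩ : ∃ t', t = shift 1 t' := by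
      rw [hi] at h
      cases t with
      | cup j => exact ⟨cup (j - 1), congrArg cup (by simp only [pos] at h; omega)⟩
      | cap j => exact ⟨cap (j - 1), congrArg cap (by simp only [pos] at h; omega)⟩
      | cross j b =>
        exact ⟨cross (j - 1) b, congrArg (cross · b) (by simp only [pos] at h; omega)⟩
    have e1 : ∀ (u : Slice) (k : ℕ), (u.shift 1).shift k = (u.shift k).shift 1 := by
      intro u k
      cases u <;> simp [shift, add_right_comm]
    have e2 : (s.shift 1).tgt = s.tgt := by cases s <;> rfl
    have e3 : (s.shift 1).src = s.src := by cases s <;> rfl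
    have e4 : ∀ u : Slice, (u.shift 1).pos = u.pos + 1 := fun u => by cases u <;> rfl
    rw [e4] at hi
    rw [e4, e4] at h
    rw [e1, e1, e2, e3]
    exact (ih s t (by omega) (by omega)).shift_one

/-- It suffices to compare two stacks at the far left. -/
theorem transferEquiv_of_zero (v w : ℕ → List Slice)
    (hv : ∀ i, v (i + 1) = (v i).map (shift 1)) (hw : ∀ i, w (i + 1) = (w i).map (shift 1))
    (h : TransferEquiv G (v 0) (w 0)) (i : ℕ) : TransferEquiv G (v i) (w i) := by
  induction i with
  | zero => exact h
  | succ i ih =>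
    rw [hv, hw]
    exact ih.shift_one

/-- At the far left each move is an identity in the core quandle `(x, y) ↦ y * x⁻¹ * y`. Its
idempotence, involutivity and self-distributivity give the three Reidemeister moves; in a zigzag,
the sum of the minimum collapses under the condition of the maximum. -/
theorem transferEquiv_isotopyMove {v w : List Slice} (h : IsotopyMove v w) :
    TransferEquiv G v w := by
  cases h with
  | exchange s t h => exact transferEquiv_exchange s t h
  | zigzag_right i =>
    refine transferEquiv_of_zero (fun i => [.cup i, .cap (i + 1)]) (fun _ => [])
      (fun _ => rfl) (fun _ => rfl) (fun f a => ?_) i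
    change ∑ x, (if x = a 0 then f (seqCons x (seqTail a)) else 0) = f a
    rw [Finset.sum_ite_eq' Finset.univ (a 0), if_pos (Finset.mem_univ _), seqCons_seqTail]
  | zigzag_left i =>
    refine transferEquiv_of_zero (fun i => [.cup (i + 1), .cap i]) (fun _ => [])
      (fun _ => rfl) (fun _ => rfl) (fun f a => ?_) i
    change ∑ x, (if a 0 = x then f (seqCons x (seqTail a)) else 0) = f a
    rw [Finset.sum_ite_eq Finset.univ (a 0), if_pos (Finset.mem_univ _), seqCons_seqTail]
  | slide_cap i b =>
    refine transferEquiv_of_zero (fun i => [.cross i b, .cap (i + 1)])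
      (fun i => [.cross (i + 1) (!b), .cap i]) (fun _ => rfl) (fun _ => rfl) (fun f a => ?_) i
    cases b
    · change (if a 1 * (a 0)⁻¹ * a 1 = a 2 then f _ else 0) =
        if a 0 = a 1 * (a 2)⁻¹ * a 1 then f _ else 0
      have e : a 1 * (a 0)⁻¹ * a 1 = a 2 ↔ a 0 = a 1 * (a 2)⁻¹ * a 1 := by
        constructor
        · intro h
          rw [← h]
          group
        · intro h
          rw [h]
          group
      simp only [e]
      rfl
    · change (if a 0 = a 2 then f (seqCons (a 0 * (a 1)⁻¹ * a 0) _) else 0) =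
        if a 0 = a 2 then f (seqCons (a 2 * (a 1)⁻¹ * a 2) _) else 0
      split_ifs with h
      · rw [h]
        rfl
      · rfl
  | slide_cup i b =>
    refine transferEquiv_of_zero (fun i => [.cup (i + 1), .cross i b])
      (fun i => [.cup i, .cross (i + 1) (!b)]) (fun _ => rfl) (fun _ => rfl) (fun f a => ?_) i
    cases b
    · rfl
    · change ∑ x, f (seqCons (a 0 * x⁻¹ * a 0) (seqCons (a 0) (seqCons x (seqTail a)))) =
        ∑ x, f (seqCons x (seqCons (a 0) (seqCons (a 0 * x⁻¹ * a 0) (seqTail a))))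
      -- The two sums differ by the substitution `x ↦ a 0 * x⁻¹ * a 0`, an involution of `G`.
      refine Fintype.sum_equiv (((Equiv.inv G).trans (Equiv.mulLeft (a 0))).trans
        (Equiv.mulRight (a 0))) _ _ fun x => ?_
      simp [mul_assoc]
  | reidemeister_one_cap i b =>
    refine transferEquiv_of_zero (fun i => [.cross i b, .cap i]) (fun i => [.cap i])
      (fun _ => rfl) (fun _ => rfl) (fun f a => ?_) i
    cases b
    · change (if a 1 = a 1 * (a 0)⁻¹ * a 1 then f _ else 0) = if a 0 = a 1 then f _ else 0
      have e : a 1 = a 1 * (a 0)⁻¹ * a 1 ↔ a 0 = a 1 := by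
        rw [mul_assoc, left_eq_mul, inv_mul_eq_one]
      simp only [e]
      rfl
    · change (if a 0 * (a 1)⁻¹ * a 0 = a 0 then f _ else 0) = if a 0 = a 1 then f _ else 0
      have e : a 0 * (a 1)⁻¹ * a 0 = a 0 ↔ a 0 = a 1 := by
        rw [mul_eq_right, mul_inv_eq_one]
      simp only [e]
      rfl
  | reidemeister_one_cup i b =>
    refine transferEquiv_of_zero (fun i => [.cup i, .cross i b]) (fun i => [.cup i])
      (fun _ => rfl) (fun _ => rfl) (fun f a => ?_) i
    cases b
    · change ∑ x, f (seqCons x (seqCons (x * x⁻¹ * x) a)) = ∑ x, f (seqCons x (seqCons x a))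
      simp
    · change ∑ x, f (seqCons (x * x⁻¹ * x) (seqCons x a)) = ∑ x, f (seqCons x (seqCons x a))
      simp
  | reidemeister_two i b =>
    refine transferEquiv_of_zero (fun i => [.cross i b, .cross i (!b)]) (fun _ => [])
      (fun _ => rfl) (fun _ => rfl) (fun f a => ?_) i
    change f (crossPair 0 (!b) (crossPair 0 b a)) = f a
    congr 1
    funext j
    rcases b with _ | _ <;> rcases j with _ | _ | j <;>
      simp [crossPair, seqCons, seqTail, mul_assoc]
  | reidemeister_three i b =>
    refine transferEquiv_of_zero (fun i => [.cross i b, .cross (i + 1) b, .cross i b])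
      (fun i => [.cross (i + 1) b, .cross i b, .cross (i + 1) b])
      (fun _ => rfl) (fun _ => rfl) (fun f a => ?_) i
    change f (crossPair 0 b (crossPair 1 b (crossPair 0 b a))) =
      f (crossPair 1 b (crossPair 0 b (crossPair 1 b a)))
    congr 1
    funext j
    rcases b with _ | _ <;> rcases j with _ | _ | _ | j <;>
      simp [crossPair, seqCons, seqTail, mul_assoc]

/-- A crossing multiplies both colours on the left by the same quotient of the two, and this
quotient stays the same; four crossings multiply by its fourth power. -/
theorem transferEquiv_twistMove (hG : ∀ g : G, g ^ 4 = 1) {v w : List Slice}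
    (h : TwistMove 4 v w) : TransferEquiv G v w := by
  cases h with
  | twist i b =>
    refine transferEquiv_of_zero (fun _ => []) (fun i => List.replicate 4 (.cross i b))
      (fun _ => rfl) (fun _ => rfl) (fun f a => ?_) i
    change f a = f (crossPair 0 b (crossPair 0 b (crossPair 0 b (crossPair 0 b a))))
    congr 1
    have h : ∀ x y z : G, (x * y⁻¹) ^ 4 * z = z := fun x y z => by rw [hG, one_mul]
    funext j
    rcases b with _ | _ <;> rcases j with _ | _ | j
    · refine (h (a 1) (a 0) _).symm.trans ?_
      simp [crossPair, seqCons, mul_assoc, pow_succ]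
    · refine (h (a 1) (a 0) _).symm.trans ?_
      simp [crossPair, seqCons, mul_assoc, pow_succ]
    · rfl
    · refine (h (a 0) (a 1) _).symm.trans ?_
      simp [crossPair, seqCons, mul_assoc, pow_succ]
    · refine (h (a 0) (a 1) _).symm.trans ?_
      simp [crossPair, seqCons, mul_assoc, pow_succ]
    · rfl

end Slice

/-! ### Invariance of the number of colourings under isotopy and 4-moves -/

namespace LinkDiagram

variable (G : Type*) [Group G] [Fintype G] [DecidableEq G]

open Classical in
/-- The number of core colourings, as a product of transfer operators. -/
noncomputable def colourCount (D : LinkDiagram) : ℕ :=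
  Slice.transferList D.slices (fun a : ℕ → G => if a = 1 then 1 else 0) 1

theorem Rewrites.colourCount_eq {ρ : List Slice → List Slice → Prop}
    (hρ : ∀ v w, ρ v w → Slice.TransferEquiv G v w) {D D' : LinkDiagram} (h : D.Rewrites ρ D') :
    D.colourCount G = D'.colourCount G := by
  obtain ⟨u, a, b, v, hab, hD, hD'⟩ := h
  unfold colourCount
  rw [hD, hD', Slice.transferList_append, Slice.transferList_append, Slice.transferList_append,
    Slice.transferList_append, funext (hρ a b hab _)]

end LinkDiagram

namespace Link

variable (G : Type*) [Group G] [Fintype G] [DecidableEq G]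

/-- The number of core colourings of a link. -/
noncomputable def colourCount : Link → ℕ :=
  Quot.lift (LinkDiagram.colourCount G) fun _ _ h =>
    h.colourCount_eq G fun _ _ => Slice.transferEquiv_isotopyMove

theorem NMoveEquivalent.colourCount_eq (hG : ∀ g : G, g ^ 4 = 1) {L L' : Link}
    (h : L.NMoveEquivalent 4 L') : L.colourCount G = L'.colourCount G := by
  induction h with
  | rel L L' h =>
    obtain ⟨D, D', rfl, rfl, h⟩ := h
    exact h.colourCount_eq G fun _ _ => Slice.transferEquiv_twistMove hG
  | refl => rfl
  | symm _ _ _ ih => exact ih.symm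
  | trans _ _ _ _ _ ih₁ ih₂ => exact ih₁.trans ih₂

theorem colourCount_circlesDiagram (k : ℕ) :
    (circlesDiagram k).colourCount G = Fintype.card G ^ k := by
  classical
  have key : ∀ f : (ℕ → G) → ℕ,
      Slice.transferList (List.replicate k [Slice.cup 0, Slice.cap 0]).flatten f =
        fun a => Fintype.card G ^ k * f a := by
    intro f
    induction k with
    | zero =>
      funext a
      exact (one_mul _).symm
    | succ k ih =>
      rw [List.replicate_succ, List.flatten_cons, Slice.transferList_append, ih]
      funext a
      -- A circle may take any colour, and its maximum imposes no further condition.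
      change ∑ x : G, (if x = x then Fintype.card G ^ k * f a else 0) = _
      simp [pow_succ']
      ring
  unfold LinkDiagram.colourCount
  change Slice.transferList (List.replicate k [Slice.cup 0, Slice.cap 0]).flatten _ _ = _
  rw [key]
  simp

end Link

/-! ## Core colourings of a diagram -/

namespace Slice

variable {G : Type*} [Group G]

/-- The colours `a` of the points on the lower line and `b` of those on the upper line of a slice
fit together. -/
def Compatible (s : Slice) (a b : ℕ → G) : Prop :=
  (∀ j < s.pos, a j = b j) ∧ (∀ j, a (s.pos + s.src + j) = b (s.pos + s.tgt + j)) ∧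
    match s with
    | cup i => b i = b (i + 1)
    | cap i => a i = a (i + 1)
    | cross i true => a i = b (i + 1) ∧ a i * (a (i + 1))⁻¹ * a i = b i
    | cross i false => a (i + 1) = b i ∧ a (i + 1) * (a i)⁻¹ * a (i + 1) = b (i + 1)

theorem compatible_shift_one (s : Slice) (a b : ℕ → G) :
    (s.shift 1).Compatible a b ↔ a 0 = b 0 ∧ s.Compatible (seqTail a) (seqTail b) := by
  have hp : (s.shift 1).pos = s.pos + 1 := by cases s <;> rfl
  have hs : (s.shift 1).src = s.src := by cases s <;> rfl
  have ht : (s.shift 1).tgt = s.tgt := by cases s <;> rfl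
  unfold Compatible
  rw [hp, hs, ht]
  have h1 : (∀ j < s.pos + 1, a j = b j) ↔
      a 0 = b 0 ∧ ∀ j < s.pos, seqTail a j = seqTail b j :=
    Nat.forall_lt_succ_left
  have h2 : (∀ j, a (s.pos + 1 + s.src + j) = b (s.pos + 1 + s.tgt + j)) ↔
      ∀ j, seqTail a (s.pos + s.src + j) = seqTail b (s.pos + s.tgt + j) := by
    refine forall_congr' fun j => ?_
    unfold seqTail
    rw [show s.pos + 1 + s.src + j = s.pos + s.src + j + 1 by ring,
      show s.pos + 1 + s.tgt + j = s.pos + s.tgt + j + 1 by ring]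
  rw [h1, h2, and_assoc]
  rcases s with i | i | ⟨i, _ | _⟩ <;> rfl


/-- With the analogues for maxima and crossings, this lists the upper rows that fit a given lower
row; they are exactly those that contribute to `transfer`. -/
theorem compatible_cup_iff (i : ℕ) (a b : ℕ → G) :
    (cup i).Compatible a b ↔ ∃ x, b = insertPair i x a := by
  induction i generalizing a b with
  | zero =>
    constructor
    · rintro ⟨-, h, h'⟩
      refine ⟨b 0, funext fun j => ?_⟩
      rcases j with _ | _ | j
      · rfl
      · exact h'.symm
      · exact (congrArg b (by simp [pos, tgt]; omega)).trans ((h j).symm.trans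
          (congrArg a (by simp [pos, src])))
    · rintro ⟨x, rfl⟩
      refine ⟨fun j hj => absurd hj (Nat.not_lt_zero j), fun j => ?_, rfl⟩
      simp [pos, src, tgt, insertPair, seqCons, Nat.add_comm 2 j]
  | succ i ih =>
    refine (compatible_shift_one (cup i) a b).trans ?_
    rw [ih]
    simp only [insertPair, eq_seqCons_iff, exists_and_left]

theorem compatible_cap_iff (i : ℕ) (a b : ℕ → G) :
    (cap i).Compatible a b ↔ a i = a (i + 1) ∧ b = deletePair i a := by
  induction i generalizing a b with
  | zero =>
    constructor
    · rintro ⟨-, h, h'⟩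
      refine ⟨h', funext fun j => ?_⟩
      exact (congrArg b (by simp [pos, tgt])).trans ((h j).symm.trans
          (congrArg a (by simp [pos, src]; omega)))
    · rintro ⟨h, rfl⟩
      refine ⟨fun j hj => absurd hj (Nat.not_lt_zero j), fun j => ?_, h⟩
      simp [pos, src, tgt, deletePair, seqTail, Nat.add_comm 2 j]
  | succ i ih =>
    refine (compatible_shift_one (cap i) a b).trans ?_
    rw [ih]
    simp only [deletePair, eq_seqCons_iff]
    exact and_left_comm

theorem compatible_cross_iff (i : ℕ) (c : Bool) (a b : ℕ → G) :
    (cross i c).Compatible a b ↔ b = crossPair i c a := by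
  induction i generalizing a b with
  | zero =>
    constructor
    · rintro ⟨-, h, h'⟩
      funext j
      rcases j with _ | _ | j
      · cases c
        exacts [h'.1.symm, h'.2.symm]
      · cases c
        exacts [h'.2.symm, h'.1.symm]
      · refine (congrArg b (by simp [pos, tgt]; omega)).trans ((h j).symm.trans
          ((congrArg a (by simp [pos, src]; omega : _ = j + 2)).trans ?_))
        cases c <;> rfl
    · rintro rfl
      refine ⟨fun j hj => absurd hj (Nat.not_lt_zero j), fun j => ?_, ?_⟩
      · cases c <;> simp [pos, src, tgt, crossPair, seqTail, seqCons, Nat.add_comm 2 j]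
      · cases c <;> exact ⟨rfl, rfl⟩
  | succ i ih =>
    refine (compatible_shift_one (cross i c) a b).trans ?_
    rw [ih]
    simp only [crossPair, eq_seqCons_iff]

theorem insertPair_injective {α : Type*} (i : ℕ) (a : ℕ → α) :
    Function.Injective fun x => insertPair i x a := by
  induction i generalizing a with
  | zero => exact fun x y h => congrFun h 0
  | succ i ih => exact fun x y h => ih (seqTail a) (congrArg seqTail h)

/-- The colourings of the points of a stack of slices, as sequences of rows, that begin with
the row `a` and are `1` on the top line and above. -/
def rowColourings (w : List Slice) (a : ℕ → G) : Set (ℕ → ℕ → G) :=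
  {c | c 0 = a ∧ (∀ (k : ℕ) (s : Slice), w[k]? = some s → s.Compatible (c k) (c (k + 1))) ∧
    ∀ k, w.length ≤ k → c k = 1}

theorem seqCons_mem_rowColourings {s : Slice} {w : List Slice} {a b : ℕ → G} {c : ℕ → ℕ → G}
    (h : s.Compatible a b) (hc : c ∈ rowColourings w b) :
    seqCons a c ∈ rowColourings (s :: w) a := by
  obtain ⟨rfl, h1, h2⟩ := hc
  refine ⟨rfl, fun k t ht => ?_, fun k hk => ?_⟩
  · cases k with
    | zero =>
      obtain rfl : s = t := by simpa using ht
      exact h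
    | succ k => exact h1 k t (by simpa using ht)
  · cases k with
    | zero => simp at hk
    | succ k => exact h2 k (by simpa using hk)

theorem exists_of_mem_rowColourings_cons {s : Slice} {w : List Slice} {a : ℕ → G}
    {c : ℕ → ℕ → G} (hc : c ∈ rowColourings (s :: w) a) :
    ∃ b, s.Compatible a b ∧ ∃ c' ∈ rowColourings w b, c = seqCons a c' := by
  obtain ⟨rfl, h1, h2⟩ := hc
  refine ⟨c 1, h1 0 s rfl, seqTail c, ⟨rfl, fun k t ht => ?_, fun k hk => ?_⟩,
    (seqCons_seqTail c).symm⟩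
  · exact h1 (k + 1) t (by simpa using ht)
  · exact h2 (k + 1) (by simpa using hk)

theorem rowColourings_nil (a : ℕ → G) :
    rowColourings [] a = {c | a = 1 ∧ c = 1} := by
  ext c
  constructor
  · rintro ⟨rfl, -, h⟩
    exact ⟨h 0 le_rfl, funext fun k => h k (Nat.zero_le k)⟩
  · rintro ⟨rfl, rfl⟩
    exact ⟨rfl, fun k s h => by simp at h, fun _ _ => rfl⟩

theorem rowColourings_eq_image {s : Slice} {w : List Slice} {a b : ℕ → G}
    (h : ∀ b', s.Compatible a b' ↔ b' = b) :
    rowColourings (s :: w) a = seqCons a '' rowColourings w b := by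
  ext c
  constructor
  · intro hc
    obtain ⟨b', hb, c', hc', rfl⟩ := exists_of_mem_rowColourings_cons hc
    obtain rfl := (h b').1 hb
    exact ⟨c', hc', rfl⟩
  · rintro ⟨c', hc', rfl⟩
    exact seqCons_mem_rowColourings ((h b).2 rfl) hc'

theorem seqCons_injective {α : Type*} (x : α) : Function.Injective (seqCons x) :=
  fun _ _ h => congrArg seqTail h

open Classical in
-- Peel off the lowest slice: a colouring is its first row `a` together with a colouring of the rest
-- that starts in a row compatible with `a`.
theorem card_rowColourings [Fintype G] (w : List Slice) (a : ℕ → G) :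
    Finite (rowColourings w a) ∧
      Nat.card (rowColourings w a) = transferList w (fun a => if a = 1 then 1 else 0) a := by
  induction w generalizing a with
  | nil =>
    rw [rowColourings_nil]
    change _ ∧ _ = if a = 1 then 1 else 0
    split_ifs with h
    · simp only [h, true_and, Set.ofPred_eq_eq_singleton]
      exact ⟨inferInstance, Nat.card_unique⟩
    · simp only [h, false_and, Set.ofPred_false]
      exact ⟨inferInstance, Nat.card_of_isEmpty⟩
  | cons s w ih =>
    cases s with
    | cup i =>
      have := fun x : G => (ih (insertPair i x a)).1
      let e : (Σ x : G, rowColourings w (insertPair i x a)) → rowColourings (cup i :: w) a :=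
        fun p => ⟨seqCons a p.2.1,
          seqCons_mem_rowColourings ((compatible_cup_iff i a _).2 ⟨p.1, rfl⟩) p.2.2⟩
      have he : Function.Bijective e := by
        constructor
        · rintro ⟨x, c, hc⟩ ⟨x', c', hc'⟩ h
          have h' : c = c' := seqCons_injective a (congrArg Subtype.val h)
          subst h'
          -- The colour of the new strand can be read off from the first row above the minimum.
          obtain rfl : x = x' := insertPair_injective i a (hc.1.symm.trans hc'.1)
          rfl
        · rintro ⟨c, hc⟩
          obtain ⟨b, hb, c', hc', rfl⟩ := exists_of_mem_rowColourings_cons hc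
          obtain ⟨x, rfl⟩ := (compatible_cup_iff i a b).1 hb
          exact ⟨⟨x, c', hc'⟩, rfl⟩
      refine ⟨Finite.of_surjective e he.2, ?_⟩
      rw [← Nat.card_congr (Equiv.ofBijective e he), Nat.card_sigma]
      exact Finset.sum_congr rfl fun x _ => (ih _).2
    | cap i =>
      change _ ∧ _ = if a i = a (i + 1) then _ else 0
      split_ifs with h
      · rw [rowColourings_eq_image fun b' => (compatible_cap_iff i a b').trans (and_iff_right h)]
        have := (ih (deletePair i a)).1
        refine ⟨inferInstance, ?_⟩
        rw [Nat.card_image_of_injective (seqCons_injective a)]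
        exact (ih _).2
      · have : IsEmpty (rowColourings (cap i :: w) a) := by
          refine ⟨fun c => ?_⟩
          obtain ⟨b, hb, -⟩ := exists_of_mem_rowColourings_cons c.2
          exact h ((compatible_cap_iff i a b).1 hb).1
        exact ⟨inferInstance, Nat.card_of_isEmpty⟩
    | cross i b =>
      rw [rowColourings_eq_image (compatible_cross_iff i b a)]
      have := (ih (crossPair i b a)).1
      refine ⟨inferInstance, ?_⟩
      rw [Nat.card_image_of_injective (seqCons_injective a)]
      exact (ih _).2

end Slice

theorem IsTangle.foldl_out {w : List Slice} {n n' : ℕ} (h : IsTangle w n n') :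
    w.foldl (fun n s => s.out n) n = n' := by
  induction w generalizing n with
  | nil => exact h
  | cons s w ih => exact ih h.2

theorem IsTangle.pos_add_src_le {w : List Slice} {n n' : ℕ} (h : IsTangle w n n') {k : ℕ}
    {s : Slice} (hs : w[k]? = some s) :
    s.pos + s.src ≤ (w.take k).foldl (fun n s => s.out n) n := by
  induction w generalizing n k with
  | nil => simp at hs
  | cons t w ih =>
    cases k with
    | zero =>
      obtain rfl : t = s := by simpa using hs
      exact h.1
    | succ k => exact ih h.2 (by simpa using hs)

namespace LinkDiagram

variable (D : LinkDiagram)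

theorem width_zero : D.width 0 = 0 := rfl

theorem width_length : D.width D.slices.length = 0 := by
  unfold width
  rw [List.take_length]
  exact D.closed.foldl_out

variable {D}

theorem pos_add_src_le_width {k : ℕ} {s : Slice} (hs : D.slices[k]? = some s) :
    s.pos + s.src ≤ D.width k :=
  D.closed.pos_add_src_le hs

theorem width_succ {k : ℕ} {s : Slice} (hs : D.slices[k]? = some s) :
    D.width (k + 1) = D.width k - s.src + s.tgt := by
  unfold width
  rw [List.take_add_one, hs, Option.toList_some, List.foldl_append]
  rfl

variable (D) (G : Type*) [Group G]

/-- The core colourings of a diagram, as functions on its points. -/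
def coreColourings : Set (D.Point → G) :=
  {φ | (∀ p q, D.Adj p q → φ p = φ q) ∧
    ∀ x y z, D.CrossingAt x y z → φ y * (φ x)⁻¹ * φ y * (φ z)⁻¹ = 1}

variable {D G}

/-- The bottom row is constantly `1`, and an entry beyond the last strand is copied from such an
entry one line below. So the padding carries no information. -/
theorem mem_rowColourings_eq_one {c : ℕ → ℕ → G} (hc : c ∈ Slice.rowColourings D.slices 1)
    {k j : ℕ} (h : ¬(k ≤ D.slices.length ∧ j < D.width k)) : c k j = 1 := by
  obtain ⟨h0, h1, h2⟩ := hc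
  rcases le_or_gt D.slices.length k with hk | hk
  · rw [h2 k hk, Pi.one_apply]
  have hj : D.width k ≤ j := by
    by_contra hj
    exact h ⟨hk.le, not_le.1 hj⟩
  clear h
  induction k generalizing j with
  | zero => rw [h0, Pi.one_apply]
  | succ k ih =>
    have hs : D.slices[k]? = some D.slices[k] := List.getElem?_eq_getElem (by omega)
    generalize D.slices[k] = s at hs
    rw [width_succ hs] at hj
    have := pos_add_src_le_width hs
    obtain ⟨j, rfl⟩ : ∃ j', j = s.pos + s.tgt + j' := ⟨j - (s.pos + s.tgt), by omega⟩
    rw [← (h1 k s hs).2.1 j]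
    exact ih (by omega) (by omega)

open Classical in
/-- The extension of a function on the points of a diagram by `1`. -/
noncomputable def extendByOne (φ : D.Point → G) (k j : ℕ) : G :=
  if h : k ≤ D.slices.length ∧ j < D.width k then φ ⟨(k, j), h⟩ else 1

theorem extendByOne_of_mem (φ : D.Point → G) {k j : ℕ}
    (h : k ≤ D.slices.length ∧ j < D.width k) : extendByOne φ k j = φ ⟨(k, j), h⟩ :=
  dif_pos h

theorem extendByOne_of_notMem (φ : D.Point → G) {k j : ℕ}
    (h : ¬(k ≤ D.slices.length ∧ j < D.width k)) : extendByOne φ k j = 1 :=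
  dif_neg h

theorem extendByOne_mem_rowColourings {φ : D.Point → G} (hφ : φ ∈ D.coreColourings G) :
    extendByOne φ ∈ Slice.rowColourings D.slices 1 := by
  refine ⟨funext fun j => extendByOne_of_notMem φ (by simp [width_zero]), fun k s hs => ?_,
    fun k hk => funext fun j => extendByOne_of_notMem φ ?_⟩
  · have hw := pos_add_src_le_width hs
    have hw' := width_succ hs
    have hk : k < D.slices.length := (List.getElem?_eq_some_iff.1 hs).1
    have joins : ∀ k' j' k'' j'', s.Joins k (k', j') (k'', j'') →
        (h' : k' ≤ D.slices.length ∧ j' < D.width k') →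
        (h'' : k'' ≤ D.slices.length ∧ j'' < D.width k'') →
        extendByOne φ k' j' = extendByOne φ k'' j'' := by
      intro k' j' k'' j'' hJ h' h''
      rw [extendByOne_of_mem φ h', extendByOne_of_mem φ h'']
      exact hφ.1 _ _ ⟨k, s, hs, hJ⟩
    have crossing : ∀ i₁ i₂ i₃, s.Crossing k (k, i₁) (k, i₂) (k + 1, i₃) →
        i₁ < D.width k → i₂ < D.width k → i₃ < D.width (k + 1) →
        extendByOne φ k i₂ * (extendByOne φ k i₁)⁻¹ * extendByOne φ k i₂ =
          extendByOne φ (k + 1) i₃ := by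
      intro i₁ i₂ i₃ hC h₁ h₂ h₃
      rw [extendByOne_of_mem φ ⟨hk.le, h₁⟩, extendByOne_of_mem φ ⟨hk.le, h₂⟩,
        extendByOne_of_mem φ ⟨hk, h₃⟩]
      exact mul_inv_eq_one.1 (hφ.2 _ _ _ ⟨k, s, hs, hC⟩)
    refine ⟨fun j hj => ?_, fun j => ?_, ?_⟩
    · exact joins _ _ _ _ (.left s k j hj) ⟨hk.le, by omega⟩ ⟨hk, by omega⟩
    · by_cases hj : s.pos + s.src + j < D.width k
      · exact joins _ _ _ _ (.right s k j) ⟨hk.le, hj⟩ ⟨hk, by omega⟩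
      · rw [extendByOne_of_notMem φ fun h => hj h.2, extendByOne_of_notMem φ fun h => ?_]
        have := h.2
        omega
    · rcases s with i | i | ⟨i, _ | _⟩ <;> simp only [Slice.pos, Slice.src, Slice.tgt] at hw hw'
      · exact joins _ _ _ _ (.cup i k) ⟨hk, by omega⟩ ⟨hk, by omega⟩
      · exact joins _ _ _ _ (.cap i k) ⟨hk.le, by omega⟩ ⟨hk.le, by omega⟩
      · exact ⟨joins _ _ _ _ (.over_false i k) ⟨hk.le, by omega⟩ ⟨hk, by omega⟩,
          crossing _ _ _ (.neg i k) (by omega) (by omega) (by omega)⟩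
      · exact ⟨joins _ _ _ _ (.over_true i k) ⟨hk.le, by omega⟩ ⟨hk, by omega⟩,
          crossing _ _ _ (.pos i k) (by omega) (by omega) (by omega)⟩
  · rintro ⟨h1, h2⟩
    obtain rfl := le_antisymm h1 hk
    rw [width_length] at h2
    exact Nat.not_lt_zero _ h2

theorem restrict_mem_coreColourings {c : ℕ → ℕ → G}
    (hc : c ∈ Slice.rowColourings D.slices 1) :
    (fun p : D.Point => c p.1.1 p.1.2) ∈ D.coreColourings G := by
  constructor
  · rintro ⟨⟨p₁, p₂⟩, hp⟩ ⟨⟨q₁, q₂⟩, hq⟩ ⟨k, s, hs, hJ⟩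
    have h := hc.2.1 k s hs
    change c p₁ p₂ = c q₁ q₂
    cases hJ with
    | left _ _ _ hj => exact h.1 _ hj
    | right => exact h.2.1 _
    | cup i _ => exact h.2.2
    | cap i _ => exact h.2.2
    | over_true i _ => exact h.2.2.1
    | over_false i _ => exact h.2.2.1
  · rintro ⟨⟨x₁, x₂⟩, hx⟩ ⟨⟨y₁, y₂⟩, hy⟩ ⟨⟨z₁, z₂⟩, hz⟩ ⟨k, s, hs, hC⟩
    have h := hc.2.1 k s hs
    change c y₁ y₂ * (c x₁ x₂)⁻¹ * c y₁ y₂ * (c z₁ z₂)⁻¹ = 1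
    cases hC with
    | pos i _ => exact mul_inv_eq_one.2 h.2.2.2
    | neg i _ => exact mul_inv_eq_one.2 h.2.2.2

variable (D G)

/-- Extension by `1` and restriction to the points of the diagram are mutually inverse. -/
theorem card_coreColourings [Fintype G] [DecidableEq G] :
    Nat.card (D.coreColourings G) = D.colourCount G := by
  have h : Nat.card (Slice.rowColourings D.slices (1 : ℕ → G)) = D.colourCount G := by
    unfold colourCount
    convert (Slice.card_rowColourings D.slices (1 : ℕ → G)).2
  rw [← h]
  refine Nat.card_congr
    { toFun := fun φ => ⟨extendByOne φ.1, extendByOne_mem_rowColourings φ.2⟩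
      invFun := fun c => ⟨_, restrict_mem_coreColourings c.2⟩
      left_inv := fun φ => Subtype.ext (funext fun p => extendByOne_of_mem φ.1 p.2)
      right_inv := fun c => Subtype.ext (funext₂ fun k j => ?_) }
  by_cases hp : k ≤ D.slices.length ∧ j < D.width k
  · exact extendByOne_of_mem _ hp
  · exact (extendByOne_of_notMem _ hp).trans (mem_rowColourings_eq_one c.2 hp).symm

/-! ### Homomorphisms from the core group, and the number of components -/

/-- The element of the core group given by the arc through a point. -/
def coreGen (p : D.Point) : D.CoreGroup := PresentedGroup.mk D.coreRelators (D.arcGen p)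

variable {D G} in
/-- A core colouring, as a function on the arcs. -/
def arcColour (φ : D.coreColourings G) : D.Arc → G := Quot.lift φ.1 φ.2.1

/-- Homomorphisms from the core group are core colourings. -/
def coreGroupHomEquiv : (D.CoreGroup →* G) ≃ D.coreColourings G where
  toFun f := ⟨fun p => f (D.coreGen p), by
    constructor
    · intro p q h
      have e : D.arcGen p = D.arcGen q := congrArg FreeGroup.of (Quot.sound h)
      exact congrArg (fun g => f (PresentedGroup.mk D.coreRelators g)) e
    · intro x y z h
      have := congrArg f (PresentedGroup.one_of_mem (rels := D.coreRelators) ⟨x, y, z, h, rfl⟩)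
      simp only [map_mul, map_inv, map_one] at this
      exact this⟩
  invFun φ := PresentedGroup.toGroup (f := arcColour φ) (by
    have e : ∀ p, FreeGroup.lift (arcColour φ) (D.arcGen p) = φ.1 p :=
      fun p => FreeGroup.lift_apply_of
    rintro _ ⟨x, y, z, h, rfl⟩
    simp only [map_mul, map_inv, e]
    exact φ.2.2 x y z h)
  left_inv f := by
    refine PresentedGroup.ext fun p => ?_
    rw [PresentedGroup.toGroup.of]
    induction p using Quot.ind
    rfl
  right_inv φ := Subtype.ext (funext fun p => PresentedGroup.toGroup.of _)

theorem card_coreGroup_hom [Fintype G] [DecidableEq G] :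
    Nat.card (D.CoreGroup →* G) = D.toLink.colourCount G :=
  (Nat.card_congr (D.coreGroupHomEquiv G)).trans (D.card_coreColourings G)

instance : Finite D.Point := by
  refine Finite.of_injective (β := Σ k : Fin (D.slices.length + 1), Fin (D.width k))
    (fun p => ⟨⟨p.1.1, Nat.lt_succ_of_le p.2.1⟩, ⟨p.1.2, p.2.2⟩⟩) ?_
  rintro ⟨⟨k, j⟩, h⟩ ⟨⟨k', j'⟩, h'⟩ e
  simp only [Sigma.mk.injEq, Fin.mk.injEq] at e
  obtain ⟨rfl, e⟩ := e
  simp only [heq_eq_eq, Fin.mk.injEq] at e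
  subst e
  rfl

instance : Finite D.Component := Quot.finite _

/-- Colourings by the group of order two are functions on the set of components. -/
theorem two_pow_numComponents :
    2 ^ D.numComponents = D.toLink.colourCount (Multiplicative (ZMod 2)) := by
  -- Here `y * y = 1`, so a crossing only forces its two underpasses to have the same colour.
  have key : ∀ x y z : Multiplicative (ZMod 2), y * x⁻¹ * y * z⁻¹ = 1 ↔ x = z := by decide
  have h : Nat.card (D.Component → Multiplicative (ZMod 2)) = 2 ^ D.numComponents := by
    rw [Nat.card_fun, numComponents]
    congr 1
    simp
  change _ = D.colourCount _
  rw [← card_coreColourings, ← h]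
  exact Nat.card_congr
    { toFun := fun f => ⟨fun p => f (Quot.mk _ p),
        fun p q h => congrArg f (Quot.sound (Or.inl h)),
        fun x y z h => (key _ _ _).2 (congrArg f (Quot.sound (Or.inr ⟨y, h⟩)))⟩
      invFun := fun φ => Quot.lift φ.1 (by
        rintro p q (h | ⟨y, h⟩)
        · exact φ.2.1 p q h
        · exact (key _ _ _).1 (φ.2.2 _ _ _ h))
      left_inv := fun f => funext fun p => by
        induction p using Quot.ind
        rfl
      right_inv := fun φ => rfl }

end LinkDiagram

/-! ## Symmetric units of the ring of power series -/

namespace NCPowerSeries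

section

variable {σ A : Type*} [CommRing A]

theorem DegreeGE.add {k : ℕ} {f g : NCPowerSeries σ A} (hf : f.DegreeGE k) (hg : g.DegreeGE k) :
    (f + g).DegreeGE k := fun w hw => by rw [add_app, hf w hw, hg w hw, add_zero]

theorem DegreeGE.tail {k : ℕ} {f : NCPowerSeries σ A} (hf : f.DegreeGE (k + 1)) (a : σ) :
    (tail a f).DegreeGE k := fun w hw => hf (a :: w) (Nat.succ_lt_succ hw)

/-- In the lowest possible degree of `g`, only the constant term of `f` contributes. Multiplication
thus merely rescales leading parts and keeps their symmetry. -/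
theorem mul_app_of_degreeGE {f g : NCPowerSeries σ A} {w : List σ} (hg : g.DegreeGE w.length) :
    (f * g) w = f [] * g w := by
  induction w generalizing f with
  | nil => exact mul_nil f g
  | cons a w ih =>
    rw [mul_cons, ih fun v hv => hg v (hv.trans (Nat.lt_succ_self _)),
      hg w (Nat.lt_succ_self _), mul_zero, add_zero]

theorem mul_app_of_degreeGE_left {f g : NCPowerSeries σ A} {w : List σ}
    (hf : f.DegreeGE w.length) : (f * g) w = f w * g [] := by
  induction w generalizing f with
  | nil => exact mul_nil f g
  | cons a w ih =>
    rw [mul_cons, ih (hf.tail a), hf [] (Nat.succ_pos _), zero_mul, zero_add]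
    rfl

theorem DegreeGE.mono {j k : ℕ} (h : j ≤ k) {f : NCPowerSeries σ A} (hf : f.DegreeGE k) :
    f.DegreeGE j := fun w hw => hf w (hw.trans_le h)

theorem DegreeGE.mul_left {k : ℕ} {g : NCPowerSeries σ A} (hg : g.DegreeGE k)
    (f : NCPowerSeries σ A) : (f * g).DegreeGE k := fun w hw => by
  rw [mul_app_of_degreeGE (hg.mono hw.le), hg w hw, mul_zero]

theorem DegreeGE.mul_right {k : ℕ} {f : NCPowerSeries σ A} (hf : f.DegreeGE k)
    (g : NCPowerSeries σ A) : (f * g).DegreeGE k := fun w hw => by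
  rw [mul_app_of_degreeGE_left (hf.mono hw.le), hf w hw, zero_mul]

theorem degreeGE_pow {f : NCPowerSeries σ A} (hf : f [] = 0) (k : ℕ) : (f ^ k).DegreeGE k := by
  induction k with
  | zero => exact fun w hw => absurd hw (Nat.not_lt_zero _)
  | succ k ih =>
    rintro (_ | ⟨a, w⟩) hw
    · rw [pow_succ', mul_nil, hf, zero_mul]
    · have hw' : w.length < k := Nat.lt_of_succ_lt_succ hw
      rw [pow_succ', mul_cons, hf, zero_mul, zero_add, mul_app_of_degreeGE (ih.mono hw'.le),
        ih w hw', mul_zero]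

/-- The leading part of a power is the power of the linear part. As coefficients commute, the
product ignores the order of the letters. -/
theorem pow_length_app {f : NCPowerSeries σ A} (hf : f [] = 0) (w : List σ) :
    (f ^ w.length) w = (w.map fun a => f [a]).prod := by
  induction w with
  | nil => rfl
  | cons a w ih =>
    rw [List.length_cons, pow_succ', mul_cons, hf, zero_mul, zero_add,
      mul_app_of_degreeGE (degreeGE_pow hf _), ih, List.map_cons, List.prod_cons]
    rfl

/-- All terms have degree at least `k`, and those of degree `k` have symmetric coefficients. -/
def LeadingSymmetric (k : ℕ) (f : NCPowerSeries σ A) : Prop :=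
  f.DegreeGE k ∧ ∀ v w : List σ, v.Perm w → v.length = k → f v = f w

theorem LeadingSymmetric.add {k : ℕ} {f g : NCPowerSeries σ A} (hf : f.LeadingSymmetric k)
    (hg : g.LeadingSymmetric k) : (f + g).LeadingSymmetric k :=
  ⟨hf.1.add hg.1, fun v w h hv => by rw [add_app, add_app, hf.2 v w h hv, hg.2 v w h hv]⟩

theorem LeadingSymmetric.mul_left {k : ℕ} {g : NCPowerSeries σ A} (hg : g.LeadingSymmetric k)
    (f : NCPowerSeries σ A) : (f * g).LeadingSymmetric k := by
  refine ⟨hg.1.mul_left f, fun v w h hv => ?_⟩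
  rw [mul_app_of_degreeGE (hv ▸ hg.1), mul_app_of_degreeGE (h.length_eq ▸ hv ▸ hg.1),
    hg.2 v w h hv]

theorem LeadingSymmetric.mul_right {k : ℕ} {f : NCPowerSeries σ A} (hf : f.LeadingSymmetric k)
    (g : NCPowerSeries σ A) : (f * g).LeadingSymmetric k := by
  refine ⟨hf.1.mul_right g, fun v w h hv => ?_⟩
  rw [mul_app_of_degreeGE_left (hv ▸ hf.1),
    mul_app_of_degreeGE_left (h.length_eq ▸ hv ▸ hf.1), hf.2 v w h hv]

theorem leadingSymmetric_pow {f : NCPowerSeries σ A} (hf : f [] = 0) (k : ℕ) :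
    (f ^ k).LeadingSymmetric k := by
  refine ⟨degreeGE_pow hf k, fun v w h hv => ?_⟩
  obtain rfl := hv
  rw [pow_length_app hf]
  conv_rhs => rw [h.length_eq]
  rw [pow_length_app hf]
  exact (h.map _).prod_eq

variable (σ A) in
/-- The group of units of the form `1 + f`, where all terms of `f` have degree at least `k` and
those of degree `k` have symmetric coefficients. -/
def symmetricUnits (k : ℕ) : Subgroup (NCPowerSeries σ A)ˣ where
  carrier := {u | LeadingSymmetric k (u - 1 : NCPowerSeries σ A)}
  one_mem' := by
    have h : ((1 : (NCPowerSeries σ A)ˣ) - 1 : NCPowerSeries σ A) = 0 := sub_self _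
    change LeadingSymmetric k _
    rw [h]
    exact ⟨fun _ _ => rfl, fun _ _ _ _ => rfl⟩
  mul_mem' {u v} hu hv := by
    have h : ((u * v : (NCPowerSeries σ A)ˣ) - 1 : NCPowerSeries σ A) =
        (u - 1) * v + (v - 1) := by
      rw [Units.val_mul]
      noncomm_ring
    change LeadingSymmetric k _
    rw [h]
    exact (LeadingSymmetric.mul_right hu _).add hv
  inv_mem' {u} hu := by
    have h : ((u⁻¹ : (NCPowerSeries σ A)ˣ) - 1 : NCPowerSeries σ A) =
        -(u⁻¹ : (NCPowerSeries σ A)ˣ) * (u - 1) := by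
      rw [neg_mul, mul_sub, Units.inv_mul, mul_one, neg_sub]
    change LeadingSymmetric k _
    rw [h]
    exact LeadingSymmetric.mul_left hu _

theorem mem_symmetricUnits {k : ℕ} {u : (NCPowerSeries σ A)ˣ} :
    u ∈ symmetricUnits σ A k ↔ LeadingSymmetric k (u - 1 : NCPowerSeries σ A) := Iff.rfl

instance (k : ℕ) : (symmetricUnits σ A k).Normal where
  conj_mem u hu v := by
    have h : ((v * u * v⁻¹ : (NCPowerSeries σ A)ˣ) - 1 : NCPowerSeries σ A) =
        v * (u - 1) * (v⁻¹ : (NCPowerSeries σ A)ˣ) := by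
      rw [mul_sub, sub_mul, mul_one, Units.mul_inv, Units.val_mul, Units.val_mul]
    rw [mem_symmetricUnits, h]
    exact LeadingSymmetric.mul_right (LeadingSymmetric.mul_left hu _) _

/-- Units with the same terms up to degree `k` are congruent modulo `symmetricUnits σ A k`. -/
theorem inv_mul_mem_symmetricUnits {k : ℕ} {u v : (NCPowerSeries σ A)ˣ}
    (h : ∀ w : List σ, w.length ≤ k → (u : NCPowerSeries σ A) w = (v : NCPowerSeries σ A) w) :
    u⁻¹ * v ∈ symmetricUnits σ A k := by
  have e : ((u⁻¹ * v : (NCPowerSeries σ A)ˣ) - 1 : NCPowerSeries σ A) =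
      (u⁻¹ : (NCPowerSeries σ A)ˣ) * (v - u) := by
    rw [mul_sub, Units.inv_mul, Units.val_mul]
  have h' : ∀ w : List σ, w.length ≤ k → (v - u : NCPowerSeries σ A) w = 0 :=
    fun w hw => sub_eq_zero.2 (h w hw).symm
  rw [mem_symmetricUnits, e]
  refine LeadingSymmetric.mul_left ⟨fun w hw => h' w hw.le, fun w w' hp hw => ?_⟩ _
  rw [h' w hw.le, h' w' (hp.length_eq ▸ hw.le)]

/-- A coset is determined by the coefficients of a representative at the finitely many words of
length at most `k`. -/
instance [Finite σ] [Finite A] (k : ℕ) :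
    Finite ((NCPowerSeries σ A)ˣ ⧸ symmetricUnits σ A k) := by
  have : Finite {w : List σ // w.length ≤ k} := (List.finite_length_le σ k).to_subtype
  refine Finite.of_injective (β := {w : List σ // w.length ≤ k} → A)
    (fun q w => (q.out : NCPowerSeries σ A) w.1) fun q q' h => ?_
  rw [← q.out_eq', ← q'.out_eq']
  exact QuotientGroup.eq.2 (inv_mul_mem_symmetricUnits fun w hw => congrFun h ⟨w, hw⟩)

end

theorem unit_app_nil {σ : Type*} (u : (NCPowerSeries σ (ZMod 2))ˣ) :
    (u : NCPowerSeries σ (ZMod 2)) [] = 1 := by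
  have h := congrFun u.mul_inv []
  rw [mul_nil] at h
  have key : ∀ x y : ZMod 2, x * y = 1 → x = 1 := by decide
  exact key _ _ h

/-- In characteristic 2, squaring `f` squares `f - 1`, since `1` is central. Doing this twice gives
`u ^ 4 - 1 = (u - 1) ^ 4`, and `u - 1` has no constant term. -/
theorem pow_four_mem_symmetricUnits {σ : Type*} (u : (NCPowerSeries σ (ZMod 2))ˣ) :
    u ^ 4 ∈ symmetricUnits σ (ZMod 2) 4 := by
  have two : ∀ f : NCPowerSeries σ (ZMod 2), f + f = 0 := fun f =>
    funext fun w => CharTwo.add_self_eq_zero (f w)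
  have sq : ∀ f : NCPowerSeries σ (ZMod 2), f ^ 2 - 1 = (f - 1) ^ 2 := fun f => by
    have h : f ^ 2 - 1 = (f - 1) ^ 2 + ((f - 1) + (f - 1)) := by noncomm_ring
    rw [h, two, add_zero]
  rw [mem_symmetricUnits, Units.val_pow_eq_pow_val, pow_mul _ 2 2, sq, sq, ← pow_mul]
  refine leadingSymmetric_pow ?_ 4
  change (u : NCPowerSeries σ (ZMod 2)) [] - 1 = 0
  rw [unit_app_nil, sub_self]

section

variable {σ A : Type*} [CommRing A] [DecidableEq σ]

theorem X_mul_nil (i : σ) (f : NCPowerSeries σ A) : (X A i * f) [] = 0 := by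
  rw [mul_nil]
  simp [X]

theorem X_mul_cons (i a : σ) (f : NCPowerSeries σ A) (w : List σ) :
    (X A i * f) (a :: w) = if a = i then f w else 0 := by
  have h : tail a (X A i) = (if a = i then (1 : A) else 0) • 1 := by
    rw [← tail_one_add_X]
    funext v
    exact (zero_add _).symm
  rw [mul_cons, h, smul_mul_app, one_mul_app]
  simp [X]

theorem X_mul_X_mul_X_mul_X_app (i : Fin 4 → σ) (w : List σ) :
    (X A (i 0) * X A (i 1) * X A (i 2) * X A (i 3)) w = if w = List.ofFn i then 1 else 0 := by
  have hi : List.ofFn i = [i 0, i 1, i 2, i 3] := by simp [List.ofFn_succ]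
  rw [mul_assoc, mul_assoc, hi]
  rcases w with _ | ⟨a, _ | ⟨b, _ | ⟨c, w⟩⟩⟩
  · simp [X_mul_nil]
  · simp [X_mul_nil, X_mul_cons]
  · simp [X_mul_nil, X_mul_cons]
  · simp only [X_mul_cons, X, List.cons.injEq]
    split_ifs <;> simp_all

end

theorem sum_app {σ A ι : Type*} [CommRing A] (s : Finset ι) (f : ι → NCPowerSeries σ A)
    (w : List σ) : (∑ i ∈ s, f i) w = ∑ i ∈ s, f i w :=
  Finset.sum_apply w s f

end NCPowerSeries

/-! ### From counting homomorphisms to the theorem -/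

/-- If `F_m / R` has as many homomorphisms to a finite group as `F_m`, then all homomorphisms
from `F_m` to this group kill `R`. -/
theorem FreeGroup.map_eq_one_of_card_presentedGroup_hom {ι G : Type*} [Finite ι] [Group G]
    [Finite G] {R : Set (FreeGroup ι)}
    (h : Nat.card (PresentedGroup R →* G) = Nat.card G ^ Nat.card ι) (f : FreeGroup ι →* G)
    {r : FreeGroup ι} (hr : r ∈ R) : f r = 1 := by
  have hF : Nat.card (FreeGroup ι →* G) = Nat.card G ^ Nat.card ι := by
    rw [← Nat.card_congr (FreeGroup.lift (α := ι) (β := G)), Nat.card_fun]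
  have : Finite (FreeGroup ι →* G) := Finite.of_equiv _ (FreeGroup.lift (α := ι) (β := G))
  have hinj : Function.Injective fun g : PresentedGroup R →* G => g.comp (PresentedGroup.mk R) :=
    fun g g' e => PresentedGroup.ext fun x => DFunLike.congr_fun e (FreeGroup.of x)
  -- An injection between finite sets of the same size is onto, so `f` factors through the quotient.
  obtain ⟨g, rfl⟩ := (hinj.bijective_of_nat_card_le (hF.trans h.symm).le).2 f
  change g (PresentedGroup.mk R r) = 1
  rw [PresentedGroup.one_of_mem hr, _root_.map_one]

theorem theorem4 (m : ℕ) (L : Link) (D : LinkDiagram) (hD : D.toLink = L)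
    (hm : D.numComponents = m) (R : Set (FreeGroup (Fin m)))
    (hR : Nonempty (D.CoreGroup ≃* PresentedGroup R))
    (hL : ∃ T : Link, T.IsTrivial ∧ L.NMoveEquivalent 4 T) :
    ∀ r ∈ R, ∃ c : (Fin 4 → Fin m) → ZMod 2,
      (∀ (τ : Equiv.Perm (Fin 4)) (i : Fin 4 → Fin m), c (fun a => i (τ a)) = c i) ∧
      ∃ d : NCPowerSeries (Fin m) (ZMod 2), d.DegreeGE 5 ∧
        (magnusExpansion 2 m r : NCPowerSeries (Fin m) (ZMod 2)) =
          1 + ∑ i : Fin 4 → Fin m, c i •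
            (NCPowerSeries.X (ZMod 2) (i 0) * NCPowerSeries.X (ZMod 2) (i 1) *
              NCPowerSeries.X (ZMod 2) (i 2) * NCPowerSeries.X (ZMod 2) (i 3)) + d := by
  classical
  obtain ⟨T, ⟨k, rfl⟩, hT⟩ := hL
  obtain ⟨e⟩ := hR
  have count : ∀ (G : Type) [Group G] [Fintype G] [DecidableEq G], (∀ g : G, g ^ 4 = 1) →
      D.toLink.colourCount G = Fintype.card G ^ k := fun G _ _ _ hG => by
    rw [hD, hT.colourCount_eq G hG]
    exact Link.colourCount_circlesDiagram G k
  -- The trivial link may have any number of components; the group of order two shows that it has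
  -- `m`.
  obtain rfl : m = k := by
    have h := D.two_pow_numComponents
    rw [hm] at h
    have h' := count (Multiplicative (ZMod 2)) (by decide)
    exact Nat.pow_right_injective le_rfl (h.trans h')
  intro r hr
  have hmem : magnusExpansion 2 m r ∈ NCPowerSeries.symmetricUnits (Fin m) (ZMod 2) 4 := by
    let N := NCPowerSeries.symmetricUnits (Fin m) (ZMod 2) 4
    let G := (NCPowerSeries (Fin m) (ZMod 2))ˣ ⧸ N
    have : Fintype G := Fintype.ofFinite _
    have hG : ∀ g : G, g ^ 4 = 1 := fun g => by
      induction g using QuotientGroup.induction_on with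
      | H u =>
        exact (QuotientGroup.eq_one_iff (u ^ 4)).2
          (NCPowerSeries.pow_four_mem_symmetricUnits u)
    have hcard : Nat.card (PresentedGroup R →* G) = Nat.card G ^ Nat.card (Fin m) := by
      rw [← Nat.card_congr e.monoidHomCongrLeftEquiv, D.card_coreGroup_hom G, count G hG,
        Nat.card_eq_fintype_card, Nat.card_fin]
    exact (QuotientGroup.eq_one_iff _).1 (FreeGroup.map_eq_one_of_card_presentedGroup_hom hcard
      ((QuotientGroup.mk' N).comp (magnusExpansion 2 m)) hr)
  obtain ⟨h1, h2⟩ := NCPowerSeries.mem_symmetricUnits.1 hmem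
  generalize (magnusExpansion 2 m r : NCPowerSeries (Fin m) (ZMod 2)) = E at h1 h2
  -- The scalars are the degree 4 coefficients of `E`, and `d` is whatever remains; it has to vanish
  -- at words of length below 5.
  refine ⟨fun i => (E - 1) (List.ofFn i), fun τ i => ?_, _, fun w hw => ?_,
    (add_sub_cancel _ E).symm⟩
  · exact h2 _ _ (Equiv.Perm.ofFn_comp_perm τ i) List.length_ofFn
  · have sub_app : ∀ f g : NCPowerSeries (Fin m) (ZMod 2), (f - g) w = f w - g w :=
      fun _ _ => rfl
    rw [← sub_sub, sub_app, NCPowerSeries.sum_app, sub_eq_zero]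
    have hterm : ∀ i : Fin 4 → Fin m, ((E - 1) (List.ofFn i) •
        (NCPowerSeries.X (ZMod 2) (i 0) * NCPowerSeries.X (ZMod 2) (i 1) *
          NCPowerSeries.X (ZMod 2) (i 2) * NCPowerSeries.X (ZMod 2) (i 3))) w =
        if w = List.ofFn i then (E - 1) w else 0 := fun i => by
      change (E - 1) (List.ofFn i) * _ = _
      rw [NCPowerSeries.X_mul_X_mul_X_mul_X_app]
      split_ifs with h
      · rw [mul_one, h]
      · exact mul_zero _
    rw [Finset.sum_congr rfl fun i _ => hterm i]
    -- Below degree 4 everything vanishes; in degree 4 exactly one summand sees the word `w`.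
    rcases Nat.lt_succ_iff_lt_or_eq.1 hw with hw | hw
    · rw [h1 w hw]
      simp
    · obtain ⟨i, rfl⟩ : ∃ i : Fin 4 → Fin m, w = List.ofFn i :=
        match w, hw with
        | [a, b, c, d], _ => ⟨![a, b, c, d], rfl⟩
      simp only [List.ofFn_inj, Finset.sum_ite_eq, Finset.mem_univ, if_true]
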